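/- Let $\mu,\varepsilon,\nu,\Omega,\omega,c_0\in\mathbb{C}$ with $\mu\neq0$, let $\lambda\in\{0,\,1-\nu\}$ be an indicial root at $x=0$ of the grand confluent hypergeometric (GCH) equation $$x y''+(\mu x^2+\varepsilon x+\nu)y'+(\Omega x+\varepsilon\omega)y=0,$$ and assume $\operatorname{Re}\lambda>-1$ and $\operatorname{Re}(\nu+\lambda)>0$ (so that the integrals below converge at $0$). Put $\gamma=\tfrac12(1+\nu)$, $z=-\tfrac12\mu x^2$, $\tilde\varepsilon=-\tfrac12\varepsilon x$, let $(a)_i$ be the rising factorial, and use principal values of powers. Let $y(x)=\sum_{n\ge0}c_nx^{n+\lambda}$ be the Frobenius series given by the leading coefficient $c_0$, $c_1=A_0c_0$ and $c_{n+1}=A_nc_n+B_nc_{n-1}$ $(n\ge1)$, where $$A_n=-\frac{\varepsilon(n+\omega+\lambda)}{(n+1+\lambda)(n+\nu+\lambda)},\qquad B_n=-\frac{\Omega+\mu(n-1+\lambda)}{(n+1+\lambda)(n+\nu+\lambda)},$$ and let $y_m(x)$ be the sub-series of $y(x)$ made of the products that contain exactly $m$ factors $A$. Then the Frobenius series converges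 for all $x\ne0$ (for all $x\in\mathbb{C}$ if $\lambda=0$), and $y$ is an analytic solution of the GCH equation on $\mathbb{C}\setminus(-\infty,0]$ (on $\mathbb{C}$ if $\lambda=0$). For all $x\neq 0$ (all $x\in\mathbb{C}$ if $\lambda=0$), with all series and integrals convergent, $$y(x)=\sum_{m=0}^\infty y_m(x)=c_0x^\lambda\Bigg\{\sum_{i_0=0}^\infty\frac{\left(\frac{\Omega}{2\mu}+\frac\lambda2\right)_{i_0}}{\left(1+\frac\lambda2\right)_{i_0}\left(\gamma+\frac\lambda2\right)_{i_0}}z^{i_0}+\sum_{n=1}^\infty\Bigg\{\prod_{j=0}^{n-1}\Bigg\{\int_0^1dt_{n-j}\,t_{n-j}^{\frac12(n-j)-1+\frac\lambda2}\int_0^1du_{n-j}\,u_{n-j}^{\gamma+\frac12(n-j)-2+\frac\lambda2}$$ $$\times\frac1{2\pi i}\oint dv_{n-j}\,\frac{\exp\left(-\frac{v_{n-j}}{1-v_{n-j}}w_{n-j+1,n}(1-t_{n-j})(1-u_{n-j})\right)}{v_{n-j}^{-\left(\frac{\Omega}{2\mu}+\frac{n-j}2+\frac\lambda2\right)+1}(1-v_{n-j})}\left(w_{n-j,n}\partial_{w_{n-j,n}}+\tfrac12(n-j-1+\omega+\lambda)\right)\Bigg\}$$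 $$\times\sum_{i_0=0}^\infty\frac{\left(\frac{\Omega}{2\mu}+\frac\lambda2\right)_{i_0}}{\left(1+\frac\lambda2\right)_{i_0}\left(\gamma+\frac\lambda2\right)_{i_0}}w_{1,n}^{i_0}\Bigg\}\tilde\varepsilon^{\,n}\Bigg\},$$ and $y_0(x)$ and $y_n(x)$ $(n\geq1)$ are, respectively, $c_0x^\lambda$ times the first series and $c_0x^\lambda$ times the $n$-th term of the sum over $n$. Here $w_{a,b}=z\prod_{l=a}^bt_lu_lv_l$ for $a\le b$ and $w_{a,b}=z$ for $a>b$; the product over $j$ is ordered, the factor $j=0$ being outermost, and each operator $w\partial_w+\text{const}$ acts on everything to its right, as a function of its $w$. The integral $\oint dv_k$ is taken once clockwise over a circle $|v_k-1|=r_k$, with arbitrary $0<r_k<1$. -/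

import Mathlib

namespace GCH

/-- `A n` in the three-term recurrence `c (n+1) = A n * c n + B n * c (n-1)` that is obtained by
inserting `∑ c n * x ^ (n + lam)` into
`x y'' + (μ x² + ε x + ν) y' + (Ω x + ε ω) y = 0`. -/
noncomputable def recA (ε ν ω lam : ℂ) (n : ℕ) : ℂ :=
  -(ε * (n + ω + lam)) / ((n + 1 + lam) * (n + ν + lam))

/-- `B n` in the same recurrence. -/
noncomputable def recB (μ ν Ω lam : ℂ) (n : ℕ) : ℂ :=
  -(Ω + μ * (n - 1 + lam)) / ((n + 1 + lam) * (n + ν + lam))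

/-- The Frobenius coefficients `c n`, with leading coefficient `c₀`. -/
noncomputable def frobCoeff (μ ε ν Ω ω lam c₀ : ℂ) : ℕ → ℂ
  | 0 => c₀
  | 1 => recA ε ν ω lam 0 * c₀
  | n + 2 => recA ε ν ω lam (n + 1) * frobCoeff μ ε ν Ω ω lam c₀ (n + 1)
      + recB μ ν Ω lam (n + 1) * frobCoeff μ ε ν Ω ω lam c₀ n

/-- The Frobenius series `y(x) = ∑ c n * x ^ (n + lam)`. -/
noncomputable def frobSeries (μ ε ν Ω ω lam c₀ x : ℂ) : ℂ :=
  ∑' n : ℕ, frobCoeff μ ε ν Ω ω lam c₀ n * x ^ ((n : ℂ) + lam)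

/-- `subCoeff … n m` is the part of `c n` that collects the products of `A`s and `B`s with
exactly `m` factors `A`; it is the coefficient of `x ^ (n + lam)` in the sub-power series `y_m`. -/
noncomputable def subCoeff (μ ε ν Ω ω lam c₀ : ℂ) : ℕ → ℕ → ℂ
  | 0, 0 => c₀
  | 0, _ + 1 => 0
  | 1, 0 => 0
  | 1, m + 1 => recA ε ν ω lam 0 * subCoeff μ ε ν Ω ω lam c₀ 0 m
  | n + 2, 0 => recB μ ν Ω lam (n + 1) * subCoeff μ ε ν Ω ω lam c₀ n 0
  | n + 2, m + 1 => recA ε ν ω lam (n + 1) * subCoeff μ ε ν Ω ω lam c₀ (n + 1) m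
      + recB μ ν Ω lam (n + 1) * subCoeff μ ε ν Ω ω lam c₀ n (m + 1)

/-- The sub-power series `y_m(x)`. -/
noncomputable def subSeries (μ ε ν Ω ω lam c₀ : ℂ) (m : ℕ) (x : ℂ) : ℂ :=
  ∑' n : ℕ, subCoeff μ ε ν Ω ω lam c₀ n m * x ^ ((n : ℂ) + lam)

/-- Rising factorial `(a)_i`. -/
noncomputable def poch (a : ℂ) (i : ℕ) : ℂ := (ascPochhammer ℂ i).eval a

/-- `γ = (1 + ν) / 2`. -/
noncomputable def gam (ν : ℂ) : ℂ := (1 + ν) / 2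

/-- The `i`-th term of the base series. -/
noncomputable def baseTerm (μ ν Ω lam w : ℂ) (i : ℕ) : ℂ :=
  poch (Ω / (2 * μ) + lam / 2) i / (poch (1 + lam / 2) i * poch (gam ν + lam / 2) i) * w ^ i

/-- The base series `∑ (Ω/(2μ) + lam/2)_i / ((1 + lam/2)_i (γ + lam/2)_i) * w ^ i`. -/
noncomputable def base (μ ν Ω lam w : ℂ) : ℂ := ∑' i : ℕ, baseTerm μ ν Ω lam w i

/-- `(1 / 2πi) ∮ f(v) dv` over the circle `|v - 1| = r`, described once *clockwise*. -/
noncomputable def contourMean (r : ℝ) (f : ℂ → ℂ) : ℂ :=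
  1 / (2 * Real.pi * Complex.I) * (-(∮ v in C(1, r), f v))

/-- The operator `w ∂_w + c`. -/
noncomputable def eulerOp (c : ℂ) (F : ℂ → ℂ) (w : ℂ) : ℂ := w * deriv F w + c * F w

/-- The integrand of the `k`-th contour integral, applied to a function `F`; here `w` stands for
`w_{k+1,n}` and `w t u v` for `w_{k,n}`. -/
noncomputable def contourIntegrand (μ Ω ω lam : ℂ) (k : ℕ) (F : ℂ → ℂ) (w : ℂ) (t u : ℝ)
    (v : ℂ) : ℂ :=
  Complex.exp (-(v / (1 - v)) * w * (1 - t) * (1 - u))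
      / (v ^ (-(Ω / (2 * μ) + k / 2 + lam / 2) + 1) * (1 - v))
    * eulerOp (1 / 2 * ((k : ℂ) - 1 + ω + lam)) F (w * t * u * v)

/-- The integrand of the `k`-th `u`-integral. -/
noncomputable def uIntegrand (μ ν Ω ω lam : ℂ) (r : ℝ) (k : ℕ) (F : ℂ → ℂ) (w : ℂ) (t u : ℝ) : ℂ :=
  (u : ℂ) ^ (gam ν + k / 2 - 2 + lam / 2)
    * contourMean r (contourIntegrand μ Ω ω lam k F w t u)

/-- The integrand of the `k`-th `t`-integral. -/
noncomputable def tIntegrand (μ ν Ω ω lam : ℂ) (r : ℝ) (k : ℕ) (F : ℂ → ℂ) (w : ℂ) (t : ℝ) : ℂ :=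
  (t : ℂ) ^ ((k : ℂ) / 2 - 1 + lam / 2)
    * ∫ u in (0 : ℝ)..1, uIntegrand μ ν Ω ω lam r k F w t u

/-- The `n`-fold nested expression, from the outermost level `n` down to level `1`, as a function
of its outermost variable `w = w_{n+1,n}`; at level `k` the contour has radius `r k`. -/
noncomputable def nested (μ ν Ω ω lam : ℂ) (r : ℕ → ℝ) : ℕ → ℂ → ℂ
  | 0 => base μ ν Ω lam
  | k + 1 => fun w =>
      ∫ t in (0 : ℝ)..1,
        tIntegrand μ ν Ω ω lam (r (k + 1)) (k + 1) (nested μ ν Ω ω lam r k) w t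

end GCH

open Filter Topology

/-! Split each Frobenius coefficient `c n` by the number `m` of factors `A`. The row sums of
`‖subCoeff n m‖` satisfy a two-term inequality whose coefficients `‖A‖`, `‖B‖` tend to `0`, so the
double series converges absolutely for every `x` (`summable_subCoeff`). Summed along `n` first it
gives `y_m`, along `m` first it gives `y`; hence `y = ∑ y_m`.

Row `n` meets column `m` only for `n = 2 i + m`, so apart from `x ^ lam` each `y_m` is `ε̃ ^ m`
times a power series in `z`. Its coefficients are matched with those of the nested integrals. At one
level, with `F = ∑ a i * w ^ i`, the Euler operator multiplies `a i` by `i + c`; Cauchy's formula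
turns the contour integral of the `l`-th term of the exponential into `(α + i)_l / (l!)²`; the `t`-
and `u`-integrals are beta integrals `l! / (s + i)_{l+1}` and `l! / (s' + i)_{l+1}`, and the
factorials cancel. The sum over `i + l = n` is the variation-of-constants solution of a first-order
recurrence in `n` (`nestedCoeff_succ_succ`): one factor `A` at position `i`, then `l` factors `B`.
This is the recurrence of `subCoeff` along `n = 2 i + m` (`subCoeff_two_mul_add`).

For the differential equation, `y = x ^ lam * P` with `P` entire; the recurrence makes every
coefficient of the reduced equation for `P` vanish. -/

/-! ### Everywhere convergent power series. -/

/-- Nonnegative sequences dominated by a two-term recurrence with vanishing coefficients decay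
faster than every geometric sequence. -/
theorem summable_of_two_term_recurrence {C p q : ℕ → ℝ} (hC : ∀ n, 0 ≤ C n)
    (hp : Tendsto p atTop (𝓝 0)) (hq : Tendsto q atTop (𝓝 0))
    (h : ∀ n, C (n + 2) ≤ p n * C (n + 1) + q n * C n) (ρ : ℝ) (hρ : 0 ≤ ρ) :
    Summable fun n => C n * ρ ^ n := by
  obtain ⟨δ, hδ, hδρ⟩ : ∃ δ : ℝ, 0 < δ ∧ δ * ρ < 1 :=
    ⟨(ρ + 1)⁻¹, by positivity, by rw [inv_mul_lt_iff₀ (by positivity)]; linarith⟩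
  -- With these thresholds each of the two terms contributes at most half of `M * δ ^ (n + 2)`.
  obtain ⟨N, hN⟩ := eventually_atTop.1
    ((hp.eventually_le_const (u := δ / 2) (by positivity)).and
      (hq.eventually_le_const (u := δ ^ 2 / 2) (by positivity)))
  obtain ⟨M, hM0, hM1, hM2⟩ : ∃ M : ℝ, 0 ≤ M ∧ C N ≤ M ∧ C (N + 1) ≤ M * δ := by
    refine ⟨C N + C (N + 1) / δ, ?_, ?_, ?_⟩
    · have := hC N; have := hC (N + 1); positivity
    · have := div_nonneg (hC (N + 1)) hδ.le; linarith
    · have := mul_nonneg (hC N) hδ.le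
      rw [add_mul, div_mul_cancel₀ _ hδ.ne']; linarith
  have key : ∀ n, C (N + n) ≤ M * δ ^ n ∧ C (N + n + 1) ≤ M * δ ^ (n + 1) := by
    intro n
    induction n with
    | zero => simpa using ⟨hM1, hM2⟩
    | succ n ih =>
      refine ⟨ih.2, (h (N + n)).trans ?_⟩
      obtain ⟨h1, h2⟩ := hN (N + n) (by omega)
      calc p (N + n) * C (N + n + 1) + q (N + n) * C (N + n)
          ≤ δ / 2 * (M * δ ^ (n + 1)) + δ ^ 2 / 2 * (M * δ ^ n) := by
            gcongr
            · exact hC _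
            · exact ih.2
            · exact hC _
            · exact ih.1
        _ = M * δ ^ (n + 1 + 1) := by ring
  rw [← summable_nat_add_iff N]
  refine Summable.of_nonneg_of_le (fun n => mul_nonneg (hC _) (by positivity)) (fun n => ?_)
    ((summable_geometric_of_lt_one (by positivity) hδρ).mul_left (M * ρ ^ N))
  calc C (n + N) * ρ ^ (n + N) ≤ (M * δ ^ n) * ρ ^ (n + N) := by
        gcongr; rw [add_comm]; exact (key n).1
    _ = M * ρ ^ N * (δ * ρ) ^ n := by rw [mul_pow, pow_add]; ring

/-- An everywhere convergent power series stays so after differentiation. -/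
theorem summable_succ_mul_pow {a : ℕ → ℂ} (h : ∀ w : ℂ, Summable fun n => a n * w ^ n) (w : ℂ) :
    Summable fun n : ℕ => ((n : ℂ) + 1) * a (n + 1) * w ^ n := by
  -- Doubling the radius gains a factor `2 ^ (n + 1)`, which absorbs `n + 1`.
  have h1 := (summable_nat_add_iff 1).2 (h ((2 * (‖w‖ + 1) : ℝ) : ℂ)).norm
  refine Summable.of_norm_bounded h1 fun n => ?_
  have h2 : ((n : ℝ) + 1) ≤ 2 ^ (n + 1) := by exact_mod_cast (Nat.lt_two_pow_self (n := n + 1)).le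
  have h3 : ‖((n : ℂ) + 1)‖ = (n : ℝ) + 1 := by
    rw [← Nat.cast_succ, Complex.norm_natCast, Nat.cast_succ]
  have h4 : ‖w‖ ^ n ≤ (‖w‖ + 1) ^ (n + 1) :=
    (pow_le_pow_left₀ (norm_nonneg _) (by linarith) n).trans
      (pow_le_pow_right₀ (by linarith [norm_nonneg w]) (by omega))
  rw [norm_mul, norm_mul, norm_mul, norm_pow, norm_pow, h3, Complex.norm_real, Real.norm_eq_abs,
    abs_of_nonneg (by positivity), mul_pow]
  calc ((n : ℝ) + 1) * ‖a (n + 1)‖ * ‖w‖ ^ n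
      ≤ 2 ^ (n + 1) * ‖a (n + 1)‖ * (‖w‖ + 1) ^ (n + 1) := by gcongr
    _ = _ := by ring

theorem hasDerivAt_tsum_mul_pow {a : ℕ → ℂ} (h : ∀ w : ℂ, Summable fun n => a n * w ^ n) (w : ℂ) :
    HasDerivAt (fun w => ∑' n, a n * w ^ n) (∑' n : ℕ, ((n : ℂ) + 1) * a (n + 1) * w ^ n) w := by
  set R : ℝ := ‖w‖ + 1
  have hR : 0 ≤ R := by positivity
  have hs := (summable_succ_mul_pow h (R : ℂ)).norm
  have hsum : Summable fun n : ℕ => ‖(n : ℂ) * a n * (R : ℂ) ^ (n - 1)‖ := by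
    rw [← summable_nat_add_iff 1]; simpa using hs
  have hw : w ∈ Metric.ball (0 : ℂ) R := by simp [R]
  have := hasDerivAt_tsum_of_isPreconnected (g := fun n w => a n * w ^ n)
    (g' := fun n w => (n : ℂ) * a n * w ^ (n - 1)) hsum Metric.isOpen_ball
    (convex_ball (0 : ℂ) R).isPreconnected
    (fun n y _ => by
      have := (hasDerivAt_pow n y).const_mul (a n)
      rwa [mul_left_comm, ← mul_assoc] at this)
    (fun n y hy => by
      rw [norm_mul, norm_mul _ ((R : ℂ) ^ _), norm_pow, norm_pow, Complex.norm_real,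
        Real.norm_of_nonneg hR]
      gcongr
      simpa using (Metric.mem_ball.1 hy).le)
    hw (h w) hw
  rw [Summable.tsum_eq_zero_add
    (by rw [← summable_nat_add_iff 1]; simpa using summable_succ_mul_pow h w)] at this
  simpa using this

theorem hasSum_mul_pow_shift {a b : ℕ → ℂ} {w s : ℂ} (h : HasSum (fun n => a n * w ^ n) s)
    (h0 : b 0 = 0) (h1 : ∀ n, b (n + 1) = a n) : HasSum (fun n => b n * w ^ n) (w * s) := by
  refine (hasSum_nat_add_iff' 1).1 ?_
  have h2 : (fun n => b (n + 1) * w ^ (n + 1)) = fun n => w * (a n * w ^ n) := by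
    funext n; rw [h1]; ring
  simpa [h0, h2] using h.mul_left w

/-- The sum of an everywhere convergent power series under `w ∂_w + c`. -/
theorem hasSum_eulerOp {a : ℕ → ℂ} {F : ℂ → ℂ} (h : ∀ w, HasSum (fun n => a n * w ^ n) (F w))
    (c w : ℂ) : HasSum (fun n : ℕ => (n + c) * a n * w ^ n) (GCH.eulerOp c F w) := by
  obtain rfl : F = fun w => ∑' n, a n * w ^ n := funext fun w => (h w).tsum_eq.symm
  have hs := fun w => (h w).summable
  have h1 := hasSum_mul_pow_shift (b := fun n => n * a n) (summable_succ_mul_pow hs w).hasSum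
    (by simp) (by simp)
  have h2 := h1.add ((hs w).hasSum.mul_left c)
  rw [GCH.eulerOp, (hasDerivAt_tsum_mul_pow hs w).deriv]
  exact h2.congr_fun fun n => by ring

/-! ### Contour integrals around `1`. -/

theorem hasSum_circleIntegral_of_summable {ι : Type*} [Countable ι] {c : ℂ} {R : ℝ} (hR : 0 ≤ R)
    {f : ι → ℂ → ℂ} {h : ℂ → ℂ} {u : ι → ℝ}
    (hf : ∀ i, ContinuousOn (f i) (Metric.sphere c R)) (hu : Summable u)
    (hfu : ∀ i, ∀ z ∈ Metric.sphere c R, ‖f i z‖ ≤ u i)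
    (hs : ∀ z ∈ Metric.sphere c R, HasSum (fun i => f i z) (h z)) :
    HasSum (fun i => ∮ z in C(c, R), f i z) (∮ z in C(c, R), h z) := by
  have hm := circleMap_mem_sphere c hR
  refine intervalIntegral.hasSum_integral_of_dominated_convergence (fun i _ => R * u i)
    (fun i => Continuous.aestronglyMeasurable ?_) (fun i => ?_) ?_ ?_ ?_
  · simp only [deriv_circleMap]
    exact (((continuous_circleMap 0 R).mul continuous_const)).smul
      ((hf i).comp_continuous (continuous_circleMap c R) hm)
  · refine .of_forall fun θ _ => ?_
    rw [norm_smul, deriv_circleMap]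
    simpa [abs_of_nonneg hR] using mul_le_mul_of_nonneg_left (hfu i _ (hm θ)) hR
  · exact .of_forall fun θ _ => hu.mul_left R
  · exact intervalIntegrable_const
  · exact .of_forall fun θ _ => (hs _ (hm θ)).const_smul _

theorem mem_slitPlane_of_norm_sub_one_lt {v : ℂ} (h : ‖v - 1‖ < 1) : v ∈ Complex.slitPlane := by
  refine Or.inl ?_
  have := (Complex.abs_re_le_norm (v - 1)).trans_lt h
  rw [Complex.sub_re, Complex.one_re, abs_lt] at this
  linarith

theorem poch_succ (a : ℂ) (n : ℕ) : GCH.poch a (n + 1) = GCH.poch a n * (a + n) :=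
  ascPochhammer_succ_eval n a

@[simp] theorem poch_zero (a : ℂ) : GCH.poch a 0 = 1 := by simp [GCH.poch]

theorem poch_eq_prod (a : ℂ) (n : ℕ) : GCH.poch a n = ∏ j ∈ Finset.range n, (a + j) := by
  induction n with
  | zero => simp
  | succ n ih => rw [poch_succ, Finset.prod_range_succ, ih]

theorem continuousOn_sphere_cpow_div_sub_one_pow {r : ℝ} (hr : r ∈ Set.Ioo (0 : ℝ) 1) (b : ℂ)
    (m : ℕ) : ContinuousOn (fun v : ℂ => v ^ b / (v - 1) ^ m) (Metric.sphere 1 r) := by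
  intro v hv
  have hv1 : ‖v - 1‖ = r := mem_sphere_iff_norm.1 hv
  have h1 := continuousAt_cpow_const (b := b)
    (mem_slitPlane_of_norm_sub_one_lt (hv1.trans_lt hr.2))
  have h2 : (v - 1) ^ m ≠ 0 := by
    refine pow_ne_zero _ fun h0 => ?_
    rw [h0, norm_zero] at hv1
    exact hr.1.ne hv1
  have h3 : ContinuousAt (fun v : ℂ => (v - 1) ^ m) v := by fun_prop
  exact (h1.div h3 h2).continuousWithinAt

/-- Cauchy's formula for the derivatives of a power at `1`. -/
theorem circleIntegral_cpow_div_sub_one_pow {r : ℝ} (hr : r ∈ Set.Ioo (0 : ℝ) 1) (β : ℂ) (l : ℕ) :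
    ∮ v in C(1, r), v ^ (β - 1 + l) / (v - 1) ^ (l + 1)
      = 2 * Real.pi * Complex.I * (GCH.poch β l / l.factorial) := by
  have hslit : ∀ v ∈ Metric.closedBall (1 : ℂ) r, v ∈ Complex.slitPlane := fun v hv =>
    mem_slitPlane_of_norm_sub_one_lt ((mem_closedBall_iff_norm.1 hv).trans_lt hr.2)
  induction l with
  | zero =>
    have hd : DifferentiableOn ℂ (fun v : ℂ => v ^ (β - 1)) (Metric.closedBall 1 r) := fun v hv =>
      (differentiableAt_id.cpow_const (hslit v hv)).differentiableWithinAt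
    have := hd.circleIntegral_sub_inv_smul (Metric.mem_ball_self hr.1)
    simpa [div_eq_inv_mul] using this
  | succ l ih =>
    have hne : ∀ v ∈ Metric.sphere (1 : ℂ) r, v - 1 ≠ 0 := fun v hv h0 => by
      rw [mem_sphere_iff_norm, h0, norm_zero] at hv; exact hr.1.ne hv
    -- The integrand is the derivative of `v ^ (β + l) / (v - 1) ^ (l + 1)`, single-valued on the
    -- circle because the disc avoids the branch cut; this yields the recursion in `l`.
    have h0 : ∮ v in C(1, r), ((β + l) * (v ^ (β - 1 + l) / (v - 1) ^ (l + 1))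
        - (l + 1) * (v ^ (β - 1 + (l + 1 : ℕ)) / (v - 1) ^ (l + 1 + 1))) = 0 := by
      refine circleIntegral.integral_eq_zero_of_hasDerivWithinAt
        (f := fun v => v ^ (β + l) / (v - 1) ^ (l + 1)) hr.1.le fun v hv => ?_
      have h1 := (hasDerivAt_id v).cpow_const (c := β + l)
        (hslit v (Metric.sphere_subset_closedBall hv))
      have h2 := ((hasDerivAt_id v).sub_const 1).pow (l + 1)
      refine ((h1.div h2 (pow_ne_zero _ (hne v hv))).congr_deriv ?_).hasDerivWithinAt
      have h3 := hne v hv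
      have e1 : β - 1 + ((l + 1 : ℕ) : ℂ) = β + l := by push_cast; ring
      have e2 : β + l - 1 = β - 1 + l := by ring
      simp only [id, e1, e2, Pi.pow_apply, mul_one, Nat.add_sub_cancel]
      push_cast
      field_simp
      ring
    have hint : ∀ (a b : ℂ) (m : ℕ), CircleIntegrable (fun v => a * (v ^ b / (v - 1) ^ m)) 1 r :=
      fun a b m => ContinuousOn.circleIntegrable hr.1.le
        (continuousOn_const.fun_mul (continuousOn_sphere_cpow_div_sub_one_pow hr b m))
    rw [circleIntegral.integral_sub (hint _ _ _) (hint _ _ _),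
      circleIntegral.integral_const_mul, circleIntegral.integral_const_mul, ih] at h0
    have h1 : (l : ℂ) + 1 ≠ 0 := Nat.cast_add_one_ne_zero l
    have h2 : (l.factorial : ℂ) ≠ 0 := Nat.cast_ne_zero.2 l.factorial_ne_zero
    rw [poch_succ, Nat.factorial_succ]
    push_cast at h0 ⊢
    apply mul_left_cancel₀ h1
    rw [← sub_eq_zero.1 h0]
    field_simp

theorem summable_norm_mul_pow {a : ℕ → ℂ} (h : ∀ w : ℂ, Summable fun n => a n * w ^ n) {ρ : ℝ}
    (hρ : 0 ≤ ρ) : Summable fun n => ‖a n‖ * ρ ^ n := by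
  simpa [abs_of_nonneg hρ] using (h ρ).norm

/-- The contour integral of an entire function against the kernel, expanded in both arguments. -/
theorem hasSum_contourMean {r : ℝ} (hr : r ∈ Set.Ioo (0 : ℝ) 1) {g : ℕ → ℂ} {G : ℂ → ℂ}
    (hg : ∀ w, HasSum (fun n => g n * w ^ n) (G w)) (α X W : ℂ) :
    HasSum (fun p : ℕ × ℕ => g p.1 * X ^ p.1
        * (GCH.poch (α + p.1) p.2 / (p.2.factorial : ℂ) ^ 2 * W ^ p.2))
      (GCH.contourMean r fun v =>
        Complex.exp (-(v / (1 - v)) * W) / (v ^ (-α + 1) * (1 - v)) * G (X * v)) := by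
  have hslit : ∀ v ∈ Metric.sphere (1 : ℂ) r, v ∈ Complex.slitPlane := fun v hv =>
    mem_slitPlane_of_norm_sub_one_lt ((mem_sphere_iff_norm.1 hv).trans_lt hr.2)
  have hne : ∀ v ∈ Metric.sphere (1 : ℂ) r, v - 1 ≠ 0 := fun v hv h0 => by
    rw [mem_sphere_iff_norm, h0, norm_zero] at hv; exact hr.1.ne hv
  have hcpow : ContinuousOn (fun v : ℂ => v ^ (α - 1)) (Metric.sphere (1 : ℂ) r) := by
    simpa using continuousOn_sphere_cpow_div_sub_one_pow hr (α - 1) 0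
  obtain ⟨M, hM⟩ := (isCompact_sphere (1 : ℂ) r).exists_bound_of_continuousOn hcpow
  have hM0 : 0 ≤ M := (norm_nonneg _).trans (hM (1 + r) (by simp [abs_of_pos hr.1]))
  -- The exponential is expanded in powers of `W * v / (v - 1)`, and all powers of `v` are merged
  -- into one.
  let f : ℕ × ℕ → ℂ → ℂ := fun p v => (g p.1 * X ^ p.1 * (W ^ p.2 / p.2.factorial))
    * (v ^ ((α + p.1) - 1 + p.2) / (v - 1) ^ (p.2 + 1))
  have hfeq : ∀ p, ∀ v ∈ Metric.sphere (1 : ℂ) r, f p v = v ^ (α - 1) / (v - 1)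
      * ((g p.1 * (X * v) ^ p.1) * ((W * v / (v - 1)) ^ p.2 / p.2.factorial)) := by
    intro p v hv
    have hv0 : v ≠ 0 := Complex.slitPlane_ne_zero (hslit v hv)
    have : (α + p.1) - 1 + p.2 = (α - 1) + ((p.1 + p.2 : ℕ) : ℂ) := by push_cast; ring
    have h3 := hne v hv
    simp only [f, this]
    rw [Complex.cpow_add _ _ hv0, Complex.cpow_natCast, mul_pow, div_pow, mul_pow]
    field_simp
    ring
  have hcont : ∀ p, ContinuousOn (f p) (Metric.sphere 1 r) := fun p =>
    continuousOn_const.fun_mul (continuousOn_sphere_cpow_div_sub_one_pow hr _ _)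
  let u : ℕ × ℕ → ℝ := fun p => M / r * ((‖g p.1‖ * (‖X‖ * 2) ^ p.1)
      * ((‖W‖ * 2 / r) ^ p.2 / p.2.factorial))
  have hu : Summable u := by
    have hr0 := hr.1
    exact (Summable.mul_of_nonneg
      (summable_norm_mul_pow (fun w => (hg w).summable) (ρ := ‖X‖ * 2) (by positivity))
      (Real.summable_pow_div_factorial (‖W‖ * 2 / r)) (fun n => by positivity)
      (fun n => by positivity)).mul_left _
  have hfu : ∀ p, ∀ v ∈ Metric.sphere (1 : ℂ) r, ‖f p v‖ ≤ u p := by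
    intro p v hv
    rw [hfeq p v hv]
    have h1 : ‖v - 1‖ = r := mem_sphere_iff_norm.1 hv
    have h2 : ‖v‖ ≤ 2 := by
      calc ‖v‖ = ‖(v - 1) + 1‖ := by rw [sub_add_cancel]
        _ ≤ ‖v - 1‖ + ‖(1 : ℂ)‖ := norm_add_le _ _
        _ ≤ 2 := by rw [h1, norm_one]; linarith [hr.2]
    simp only [norm_mul, norm_div, norm_pow, h1, RCLike.norm_natCast, u]
    have := hr.1
    gcongr
    exact hM v hv
  -- The minus sign comes from `1 - v = -(v - 1)`; it cancels against the clockwise orientation.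
  have hs : ∀ v ∈ Metric.sphere (1 : ℂ) r, HasSum (fun p => f p v)
      (-(Complex.exp (-(v / (1 - v)) * W) / (v ^ (-α + 1) * (1 - v)) * G (X * v))) := by
    intro v hv
    have h3 := hne v hv
    have h4 : 1 - v ≠ 0 := fun h => h3 (by linear_combination -h)
    have hv0 : v ≠ 0 := Complex.slitPlane_ne_zero (hslit v hv)
    have he : HasSum (fun n : ℕ => (W * v / (v - 1)) ^ n / n.factorial)
        (Complex.exp (-(v / (1 - v)) * W)) := by
      have e : -(v / (1 - v)) * W = W * v / (v - 1) := by
        have h6 : 1 - v = -(v - 1) := by ring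
        rw [h6]; field_simp
      rw [e, Complex.exp_eq_exp_ℂ]
      exact NormedSpace.expSeries_div_hasSum_exp _
    have hsum := summable_mul_of_summable_norm (f := fun n => g n * (X * v) ^ n)
      (g := fun n : ℕ => (W * v / (v - 1)) ^ n / (n.factorial : ℂ)) (hg (X * v)).summable.norm
      he.summable.norm
    have hs := (hg (X * v)).mul he hsum
    have e : -(Complex.exp (-(v / (1 - v)) * W) / (v ^ (-α + 1) * (1 - v)) * G (X * v))
        = v ^ (α - 1) / (v - 1) * (G (X * v) * Complex.exp (-(v / (1 - v)) * W)) := by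
      have : v ^ (-α + 1) = (v ^ (α - 1))⁻¹ := by
        rw [← Complex.cpow_neg]; congr 1; ring
      have h5 : v ^ (α - 1) ≠ 0 := by simp [Complex.cpow_eq_zero_iff, hv0]
      rw [this]
      have h6 : 1 - v = -(v - 1) := by ring
      generalize Complex.exp (-(v / (1 - v)) * W) = E
      rw [h6]
      field_simp
    rw [e]
    exact (hs.mul_left _).congr_fun fun p => hfeq p v hv
  have key := hasSum_circleIntegral_of_summable hr.1.le hcont hu hfu hs
  have key2 := key.mul_left (1 / (2 * Real.pi * Complex.I))
  have hneg : (∮ v in C(1, r), -(Complex.exp (-(v / (1 - v)) * W) / (v ^ (-α + 1) * (1 - v))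
      * G (X * v))) = -∮ v in C(1, r), Complex.exp (-(v / (1 - v)) * W)
        / (v ^ (-α + 1) * (1 - v)) * G (X * v) := by
    simp [circleIntegral]
  rw [hneg] at key2
  refine key2.congr_fun fun p => ?_
  have h2 : (2 * Real.pi * Complex.I : ℂ) ≠ 0 := Complex.two_pi_I_ne_zero
  have h3 : ∮ v in C(1, r), f p v = (g p.1 * X ^ p.1 * (W ^ p.2 / p.2.factorial))
      * (2 * Real.pi * Complex.I * (GCH.poch (α + p.1) p.2 / p.2.factorial)) := by
    rw [← circleIntegral_cpow_div_sub_one_pow hr (α + p.1) p.2]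
    exact circleIntegral.integral_const_mul _ _ _ _
  rw [h3]
  field_simp

/-! ### Beta integrals. -/

theorem betaIntegral_add_nat {s : ℂ} (hs : 0 < s.re) (i l : ℕ) :
    Complex.betaIntegral (s + i) (l + 1) = l.factorial / GCH.poch (s + i) (l + 1) := by
  rw [Complex.betaIntegral_eval_nat_add_one_right, poch_eq_prod]
  simp only [Complex.add_re, Complex.natCast_re]
  positivity

theorem norm_pow_mul_one_sub_pow_le_one {t : ℝ} (ht : t ∈ Set.Icc (0 : ℝ) 1) (i l : ℕ) :
    ‖(t : ℂ) ^ i * (1 - (t : ℂ)) ^ l‖ ≤ 1 := by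
  have h1 : ‖(t : ℂ)‖ ≤ 1 := by
    rw [Complex.norm_real, Real.norm_of_nonneg ht.1]; exact ht.2
  have h2 : ‖(1 - t : ℂ)‖ ≤ 1 := by
    rw [← Complex.ofReal_one, ← Complex.ofReal_sub, Complex.norm_real,
      Real.norm_of_nonneg (by linarith [ht.2])]
    linarith [ht.1]
  rw [norm_mul, norm_pow, norm_pow]
  exact mul_le_one₀ (pow_le_one₀ (norm_nonneg _) h1) (by positivity)
    (pow_le_one₀ (norm_nonneg _) h2)

/-- Termwise beta integration of an absolutely convergent expansion in Bernstein monomials. -/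
theorem hasSum_integral_cpow_mul {s : ℂ} (hs : 0 < s.re) {q : ℕ × ℕ → ℂ} (hq : Summable q)
    {f : ℝ → ℂ} (hf : ∀ t ∈ Set.Icc (0 : ℝ) 1,
      HasSum (fun p : ℕ × ℕ => q p * ((t : ℂ) ^ p.1 * (1 - (t : ℂ)) ^ p.2)) (f t)) :
    IntervalIntegrable (fun t : ℝ => (t : ℂ) ^ (s - 1) * f t) MeasureTheory.volume 0 1 ∧
      HasSum (fun p : ℕ × ℕ => q p * Complex.betaIntegral (s + p.1) (p.2 + 1))
        (∫ t in (0 : ℝ)..1, (t : ℂ) ^ (s - 1) * f t) := by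
  have hbound : ∀ (p : ℕ × ℕ), ∀ t ∈ Set.Icc (0 : ℝ) 1,
      ‖q p * ((t : ℂ) ^ p.1 * (1 - (t : ℂ)) ^ p.2)‖ ≤ ‖q p‖ := fun p t ht => by
    rw [norm_mul]
    exact mul_le_of_le_one_right (norm_nonneg _) (norm_pow_mul_one_sub_pow_le_one ht _ _)
  have hcpow : IntervalIntegrable (fun t : ℝ => (t : ℂ) ^ (s - 1)) MeasureTheory.volume 0 1 :=
    intervalIntegral.intervalIntegrable_cpow' (by simpa using hs)
  -- A uniform limit of polynomials, hence integrable against `t ^ (s - 1)`.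
  have hcont : ContinuousOn f (Set.Icc 0 1) :=
    (continuousOn_tsum (fun p => Continuous.continuousOn (by fun_prop)) hq.norm hbound).congr
      fun t ht => (hf t ht).tsum_eq.symm
  have hIoc : ∀ t ∈ Set.uIoc (0 : ℝ) 1, t ∈ Set.Icc (0 : ℝ) 1 := fun t ht => by
    rw [Set.uIoc_of_le zero_le_one] at ht
    exact Set.Ioc_subset_Icc_self ht
  refine ⟨hcpow.mul_continuousOn (by rwa [Set.uIcc_of_le zero_le_one]), ?_⟩
  have key := intervalIntegral.hasSum_integral_of_dominated_convergence
    (F := fun (p : ℕ × ℕ) (t : ℝ) => (t : ℂ) ^ (s - 1)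
      * (q p * ((t : ℂ) ^ p.1 * (1 - (t : ℂ)) ^ p.2)))
    (f := fun t : ℝ => (t : ℂ) ^ (s - 1) * f t) (a := 0) (b := 1) (μ := MeasureTheory.volume)
    (fun p t => ‖(t : ℂ) ^ (s - 1)‖ * ‖q p‖)
    (fun p => by
      have h1 := hcpow.aestronglyMeasurable_restrict_uIoc
      have h2 : Continuous fun t : ℝ => q p * ((t : ℂ) ^ p.1 * (1 - (t : ℂ)) ^ p.2) := by
        fun_prop
      exact h1.mul h2.aestronglyMeasurable)
    (fun p => .of_forall fun t ht => by
      rw [norm_mul]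
      exact mul_le_mul_of_nonneg_left (hbound p t (hIoc t ht)) (norm_nonneg _))
    (.of_forall fun t _ => hq.norm.mul_left _)
    (by simp only [tsum_mul_left]; exact hcpow.norm.mul_const _)
    (.of_forall fun t ht => (hf t (hIoc t ht)).mul_left _)
  refine key.congr_fun fun p => ?_
  rw [Complex.betaIntegral, ← intervalIntegral.integral_const_mul]
  refine intervalIntegral.integral_congr_ae (.of_forall fun t ht => ?_)
  rw [Set.uIoc_of_le zero_le_one] at ht
  have ht0 : (t : ℂ) ≠ 0 := Complex.ofReal_ne_zero.2 ht.1.ne'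
  have e1 : s + p.1 - 1 = (s - 1) + (p.1 : ℂ) := by ring
  simp only [e1, add_sub_cancel_right]
  rw [Complex.cpow_add _ _ ht0, Complex.cpow_natCast, Complex.cpow_natCast]
  ring

theorem HasSum.antidiagonal {f : ℕ × ℕ → ℂ} {s : ℂ} (h : HasSum f s) :
    HasSum (fun n => ∑ p ∈ Finset.HasAntidiagonal.antidiagonal n, f p) s := by
  refine ((Finset.HasAntidiagonal.sigmaAntidiagonalEquivProd (A := ℕ)).hasSum_iff.2 h).sigma
    fun n => ?_
  simpa [Finset.sum_attach _ f] using hasSum_fintype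
    fun p : Finset.HasAntidiagonal.antidiagonal n => f p

/-! ### One level of the nested integral. -/

/-- The coefficients of the power series of `GCH.nested`. -/
noncomputable def nestedCoeff (μ ν Ω ω lam : ℂ) : ℕ → ℕ → ℂ
  | 0, n => GCH.poch (Ω / (2 * μ) + lam / 2) n
      / (GCH.poch (1 + lam / 2) n * GCH.poch (GCH.gam ν + lam / 2) n)
  | k + 1, n => ∑ p ∈ Finset.HasAntidiagonal.antidiagonal n,
      ((p.1 : ℂ) + 1 / 2 * (((k + 1 : ℕ) : ℂ) - 1 + ω + lam)) * nestedCoeff μ ν Ω ω lam k p.1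
        * GCH.poch (Ω / (2 * μ) + ((k + 1 : ℕ) : ℂ) / 2 + lam / 2 + p.1) p.2
        / (GCH.poch (((k + 1 : ℕ) : ℂ) / 2 + lam / 2 + p.1) (p.2 + 1)
          * GCH.poch (GCH.gam ν + ((k + 1 : ℕ) : ℂ) / 2 - 1 + lam / 2 + p.1) (p.2 + 1))

section Level

variable {μ ν Ω ω lam : ℂ} {r : ℝ} {k : ℕ} {F : ℂ → ℂ} {a : ℕ → ℂ}

theorem circleIntegrable_contourIntegrand (hr : r ∈ Set.Ioo (0 : ℝ) 1) (hF : Differentiable ℂ F)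
    (w : ℂ) (t u : ℝ) : CircleIntegrable (GCH.contourIntegrand μ Ω ω lam k F w t u) 1 r := by
  refine ContinuousOn.circleIntegrable hr.1.le ?_
  have hF' : Continuous (deriv F) := hF.deriv.continuous
  have hFc := hF.continuous
  have h0 : ∀ v ∈ Metric.sphere (1 : ℂ) r, 1 - v ≠ 0 := fun v hv h0 => by
    rw [mem_sphere_iff_norm, norm_sub_rev, h0, norm_zero] at hv; exact hr.1.ne hv
  have hslit : ∀ v ∈ Metric.sphere (1 : ℂ) r, v ∈ Complex.slitPlane := fun v hv =>
    mem_slitPlane_of_norm_sub_one_lt ((mem_sphere_iff_norm.1 hv).trans_lt hr.2)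
  have hpow : ∀ b : ℂ, ContinuousOn (fun v : ℂ => v ^ b) (Metric.sphere 1 r) := fun b v hv =>
    (continuousAt_cpow_const (hslit v hv)).continuousWithinAt
  have h1 : ContinuousOn (fun v : ℂ => v / (1 - v)) (Metric.sphere 1 r) :=
    continuousOn_id.div₀ (by fun_prop) h0
  unfold GCH.contourIntegrand GCH.eulerOp
  refine ContinuousOn.fun_mul (ContinuousOn.div₀ (by fun_prop) ?_ ?_) (by fun_prop)
  · exact (hpow _).fun_mul (by fun_prop)
  · intro v hv
    exact mul_ne_zero (by simp [Complex.cpow_eq_zero_iff, Complex.slitPlane_ne_zero (hslit v hv)])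
      (h0 v hv)

/-- The `(i, l)`-coefficient of the expanded contour integral of level `k`. -/
noncomputable def contourCoeff (μ Ω ω lam : ℂ) (k : ℕ) (a : ℕ → ℂ) (p : ℕ × ℕ) : ℂ :=
  (p.1 + 1 / 2 * ((k : ℂ) - 1 + ω + lam)) * a p.1
    * (GCH.poch (Ω / (2 * μ) + k / 2 + lam / 2 + p.1) p.2 / (p.2.factorial : ℂ) ^ 2)

theorem summable_contourCoeff (hr : r ∈ Set.Ioo (0 : ℝ) 1)
    (ha : ∀ w, HasSum (fun n => a n * w ^ n) (F w)) (w : ℂ) :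
    Summable fun p : ℕ × ℕ => contourCoeff μ Ω ω lam k a p * w ^ (p.1 + p.2) := by
  refine (hasSum_contourMean hr (hasSum_eulerOp ha (1 / 2 * ((k : ℂ) - 1 + ω + lam)))
    (Ω / (2 * μ) + k / 2 + lam / 2) w w).summable.congr fun p => ?_
  rw [contourCoeff, pow_add]; ring

theorem hasSum_contourMean_contourIntegrand (hr : r ∈ Set.Ioo (0 : ℝ) 1)
    (ha : ∀ w, HasSum (fun n => a n * w ^ n) (F w)) (w : ℂ) (t u : ℝ) :
    HasSum (fun p : ℕ × ℕ => contourCoeff μ Ω ω lam k a p * w ^ (p.1 + p.2)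
        * ((t : ℂ) ^ p.1 * (1 - (t : ℂ)) ^ p.2) * ((u : ℂ) ^ p.1 * (1 - (u : ℂ)) ^ p.2))
      (GCH.contourMean r (GCH.contourIntegrand μ Ω ω lam k F w t u)) := by
  have key := hasSum_contourMean hr (hasSum_eulerOp ha (1 / 2 * ((k : ℂ) - 1 + ω + lam)))
    (Ω / (2 * μ) + k / 2 + lam / 2) (w * t * u) (w * (1 - t) * (1 - u))
  have e : GCH.contourIntegrand μ Ω ω lam k F w t u = fun v =>
      Complex.exp (-(v / (1 - v)) * (w * (1 - t) * (1 - u)))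
        / (v ^ (-(Ω / (2 * μ) + k / 2 + lam / 2) + 1) * (1 - v))
        * GCH.eulerOp (1 / 2 * ((k : ℂ) - 1 + ω + lam)) F (w * t * u * v) := by
    funext v; simp only [GCH.contourIntegrand, mul_assoc]
  rw [e]
  refine key.congr_fun fun p => ?_
  simp only [contourCoeff, mul_pow, pow_add]; ring

theorem uIntegrand_expansion (hr : r ∈ Set.Ioo (0 : ℝ) 1)
    (hu : 0 < (GCH.gam ν + k / 2 - 1 + lam / 2).re)
    (ha : ∀ w, HasSum (fun n => a n * w ^ n) (F w)) (w : ℂ) {t : ℝ} (ht : t ∈ Set.Icc (0 : ℝ) 1) :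
    IntervalIntegrable (GCH.uIntegrand μ ν Ω ω lam r k F w t) MeasureTheory.volume 0 1 ∧
      HasSum (fun p : ℕ × ℕ => contourCoeff μ Ω ω lam k a p * w ^ (p.1 + p.2)
          * Complex.betaIntegral (GCH.gam ν + k / 2 - 1 + lam / 2 + p.1) (p.2 + 1)
          * ((t : ℂ) ^ p.1 * (1 - (t : ℂ)) ^ p.2))
        (∫ u in (0 : ℝ)..1, GCH.uIntegrand μ ν Ω ω lam r k F w t u) := by
  have hq : Summable fun p : ℕ × ℕ => contourCoeff μ Ω ω lam k a p * w ^ (p.1 + p.2)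
      * ((t : ℂ) ^ p.1 * (1 - (t : ℂ)) ^ p.2) :=
    Summable.of_norm_bounded (summable_contourCoeff hr ha w).norm fun p => by
      rw [norm_mul]
      exact mul_le_of_le_one_right (norm_nonneg _) (norm_pow_mul_one_sub_pow_le_one ht _ _)
  have key := hasSum_integral_cpow_mul hu hq
    fun u _ => hasSum_contourMean_contourIntegrand hr ha w t u
  have e : GCH.uIntegrand μ ν Ω ω lam r k F w t = fun u : ℝ =>
      (u : ℂ) ^ (GCH.gam ν + k / 2 - 1 + lam / 2 - 1)
        * GCH.contourMean r (GCH.contourIntegrand μ Ω ω lam k F w t u) := by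
    funext u
    have : GCH.gam ν + k / 2 - 2 + lam / 2 = GCH.gam ν + k / 2 - 1 + lam / 2 - 1 := by ring
    rw [GCH.uIntegrand, this]
  rw [e]
  exact ⟨key.1, key.2.congr_fun fun p => by ring⟩

theorem tIntegrand_expansion (hr : r ∈ Set.Ioo (0 : ℝ) 1)
    (ht : 0 < ((k : ℂ) / 2 + lam / 2).re) (hu : 0 < (GCH.gam ν + k / 2 - 1 + lam / 2).re)
    (ha : ∀ w, HasSum (fun n => a n * w ^ n) (F w)) (w : ℂ) :
    IntervalIntegrable (GCH.tIntegrand μ ν Ω ω lam r k F w) MeasureTheory.volume 0 1 ∧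
      HasSum (fun p : ℕ × ℕ => contourCoeff μ Ω ω lam k a p * w ^ (p.1 + p.2)
          * Complex.betaIntegral (GCH.gam ν + k / 2 - 1 + lam / 2 + p.1) (p.2 + 1)
          * Complex.betaIntegral ((k : ℂ) / 2 + lam / 2 + p.1) (p.2 + 1))
        (∫ t in (0 : ℝ)..1, GCH.tIntegrand μ ν Ω ω lam r k F w t) := by
  have hs := summable_contourCoeff (μ := μ) (Ω := Ω) (ω := ω) (lam := lam) (k := k) hr ha w
  -- Only summability of the coefficients times the `u`-beta integrals is wanted; it is read off
  -- from termwise integration of the auxiliary sum of the same coefficients.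
  have hq := (hasSum_integral_cpow_mul hu hs fun t ht => (Summable.of_norm_bounded hs.norm
    fun p => by
      rw [norm_mul]
      exact mul_le_of_le_one_right (norm_nonneg _)
        (norm_pow_mul_one_sub_pow_le_one ht _ _)).hasSum).2.summable
  have key := hasSum_integral_cpow_mul ht hq fun t ht => (uIntegrand_expansion hr hu ha w ht).2
  have e : GCH.tIntegrand μ ν Ω ω lam r k F w = fun t : ℝ =>
      (t : ℂ) ^ ((k : ℂ) / 2 + lam / 2 - 1)
        * ∫ u in (0 : ℝ)..1, GCH.uIntegrand μ ν Ω ω lam r k F w t u := by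
    funext t
    have : (k : ℂ) / 2 - 1 + lam / 2 = (k : ℂ) / 2 + lam / 2 - 1 := by ring
    rw [GCH.tIntegrand, this]
  rw [e]
  exact key

end Level

theorem re_half_pos {lam : ℂ} (ht : -1 < lam.re) (k : ℕ) :
    0 < (((k + 1 : ℕ) : ℂ) / 2 + lam / 2).re := by
  have e : ((((k + 1 : ℕ) : ℂ) / 2 + lam / 2)).re = ((k : ℝ) + 1 + lam.re) / 2 := by
    rw [← add_div, Complex.div_ofNat_re]; simp
  rw [e]
  have := k.cast_nonneg (α := ℝ)
  linarith

theorem re_gam_pos {ν lam : ℂ} (hu : 0 < (ν + lam).re) (k : ℕ) :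
    0 < (GCH.gam ν + ((k + 1 : ℕ) : ℂ) / 2 - 1 + lam / 2).re := by
  have e : GCH.gam ν + ((k + 1 : ℕ) : ℂ) / 2 - 1 + lam / 2 = ((k : ℂ) + (ν + lam)) / 2 := by
    rw [GCH.gam]; push_cast; ring
  rw [e, Complex.div_ofNat_re, Complex.add_re, Complex.natCast_re]
  have := k.cast_nonneg (α := ℝ)
  linarith

theorem hasSum_nested_succ {μ ν Ω ω lam : ℂ} (ht : -1 < lam.re) (hu : 0 < (ν + lam).re)
    {r : ℕ → ℝ} (hr : ∀ k, r k ∈ Set.Ioo (0 : ℝ) 1) {k : ℕ}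
    (h : ∀ w, HasSum (fun n => nestedCoeff μ ν Ω ω lam k n * w ^ n)
      (GCH.nested μ ν Ω ω lam r k w)) (w : ℂ) :
    HasSum (fun n => nestedCoeff μ ν Ω ω lam (k + 1) n * w ^ n)
      (GCH.nested μ ν Ω ω lam r (k + 1) w) := by
  refine (tIntegrand_expansion (hr (k + 1)) (re_half_pos ht k) (re_gam_pos hu k) h w).2.antidiagonal
    |>.congr_fun fun n => ?_
  rw [nestedCoeff, Finset.sum_mul]
  refine Finset.sum_congr rfl fun p hp => ?_
  rw [betaIntegral_add_nat (re_half_pos ht k), betaIntegral_add_nat (re_gam_pos hu k),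
    contourCoeff, Finset.HasAntidiagonal.mem_antidiagonal.1 hp]
  -- The two beta integrals supply the `(l!)²` that cancels the denominator in `contourCoeff`.
  have : (p.2.factorial : ℂ) ≠ 0 := Nat.cast_ne_zero.2 p.2.factorial_ne_zero
  field_simp

/-! ### The three-term recurrence and its sub-series. -/

section Recurrence

variable {μ ε ν Ω ω lam c₀ : ℂ}

theorem natCast_add_one_add_ne_zero (ht : -1 < lam.re) (n : ℕ) : (n : ℂ) + 1 + lam ≠ 0 := by
  intro h
  have := congrArg Complex.re h
  simp only [Complex.add_re, Complex.natCast_re, Complex.one_re, Complex.zero_re] at this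
  linarith [n.cast_nonneg (α := ℝ)]

theorem natCast_add_add_ne_zero (hu : 0 < (ν + lam).re) (n : ℕ) : (n : ℂ) + ν + lam ≠ 0 := by
  intro h
  have := congrArg Complex.re h
  simp only [Complex.add_re, Complex.natCast_re, Complex.zero_re] at this hu
  linarith [n.cast_nonneg (α := ℝ)]

theorem tendsto_inv_natCast_add (c : ℂ) : Tendsto (fun n : ℕ => ((n : ℂ) + c)⁻¹) atTop (𝓝 0) :=
  tendsto_inv₀_cobounded.comp ((tendsto_add_const_cobounded c).comp tendsto_natCast_atTop_cobounded)

theorem tendsto_recA (ht : -1 < lam.re) : Tendsto (GCH.recA ε ν ω lam) atTop (𝓝 0) := by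
  -- Uses `(n + ω + lam) / (n + 1 + lam) = 1 + (ω - 1) / (n + 1 + lam)`.
  have h := (((tendsto_inv_natCast_add (1 + lam)).const_mul (ω - 1)).const_add 1).mul
    ((tendsto_inv_natCast_add (ν + lam)).const_mul (-ε))
  simp only [mul_zero] at h
  refine h.congr fun n => ?_
  have h1 := natCast_add_one_add_ne_zero ht n
  rw [GCH.recA, div_eq_mul_inv, mul_inv, ← add_assoc, ← add_assoc]
  field_simp
  ring

theorem tendsto_recB (ht : -1 < lam.re) : Tendsto (GCH.recB μ ν Ω lam) atTop (𝓝 0) := by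
  have h := (((tendsto_inv_natCast_add (1 + lam)).const_mul (Ω - 2 * μ)).const_add μ).mul
    ((tendsto_inv_natCast_add (ν + lam)).const_mul (-1))
  simp only [mul_zero] at h
  refine h.congr fun n => ?_
  have h1 := natCast_add_one_add_ne_zero ht n
  rw [GCH.recB, div_eq_mul_inv, mul_inv, ← add_assoc, ← add_assoc]
  field_simp
  ring

/-- Only the entries `(2 i + m, m)` of `subCoeff` are nonzero. -/
theorem subCoeff_eq_zero : ∀ n m : ℕ, (∀ i, n ≠ 2 * i + m) →
    GCH.subCoeff μ ε ν Ω ω lam c₀ n m = 0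
  | 0, 0, h => absurd rfl (h 0)
  | 0, m + 1, _ => by rw [GCH.subCoeff]
  | 1, 0, _ => by rw [GCH.subCoeff]
  | 1, m + 1, h => by
    rw [GCH.subCoeff, subCoeff_eq_zero 0 m fun i hi => h i (by omega), mul_zero]
  | n + 2, 0, h => by
    rw [GCH.subCoeff, subCoeff_eq_zero n 0 fun i hi => h (i + 1) (by omega), mul_zero]
  | n + 2, m + 1, h => by
    rw [GCH.subCoeff, subCoeff_eq_zero (n + 1) m fun i hi => h i (by omega),
      subCoeff_eq_zero n (m + 1) fun i hi => h (i + 1) (by omega), mul_zero, mul_zero, add_zero]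

theorem subCoeff_eq_zero_of_lt {n m : ℕ} (h : n < m) :
    GCH.subCoeff μ ε ν Ω ω lam c₀ n m = 0 :=
  subCoeff_eq_zero n m fun i hi => by omega

/-- `N` is left free because splitting off `m = 0` calls the preceding rows with different ranges.
-/
theorem sum_subCoeff : ∀ n N : ℕ, n < N →
    ∑ m ∈ Finset.range N, GCH.subCoeff μ ε ν Ω ω lam c₀ n m
      = GCH.frobCoeff μ ε ν Ω ω lam c₀ n
  | 0, N + 1, _ => by
    rw [Finset.sum_range_succ', GCH.frobCoeff]
    simp [GCH.subCoeff]
  | 1, N + 1, h => by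
    rw [Finset.sum_range_succ', GCH.frobCoeff]
    simp only [GCH.subCoeff]
    rw [← Finset.mul_sum, sum_subCoeff 0 N (by omega), GCH.frobCoeff, add_zero]
  | n + 2, N + 1, h => by
    rw [Finset.sum_range_succ', GCH.frobCoeff]
    simp only [GCH.subCoeff]
    rw [Finset.sum_add_distrib, ← Finset.mul_sum, ← Finset.mul_sum,
      sum_subCoeff (n + 1) N (by omega), add_assoc, ← mul_add, ← Finset.sum_range_succ' _ N,
      sum_subCoeff n (N + 1) (by omega)]

theorem sum_norm_subCoeff_of_lt {n N : ℕ} (h : n < N) :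
    ∑ m ∈ Finset.range N, ‖GCH.subCoeff μ ε ν Ω ω lam c₀ n m‖
      = ∑ m ∈ Finset.range (n + 1), ‖GCH.subCoeff μ ε ν Ω ω lam c₀ n m‖ := by
  refine (Finset.sum_subset (Finset.range_mono h) fun m _ hm => ?_).symm
  rw [subCoeff_eq_zero_of_lt (by simpa using hm), norm_zero]

theorem sum_norm_subCoeff_le (n : ℕ) :
    ∑ m ∈ Finset.range (n + 2 + 1), ‖GCH.subCoeff μ ε ν Ω ω lam c₀ (n + 2) m‖
      ≤ ‖GCH.recA ε ν ω lam (n + 1)‖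
          * ∑ m ∈ Finset.range (n + 1 + 1), ‖GCH.subCoeff μ ε ν Ω ω lam c₀ (n + 1) m‖
        + ‖GCH.recB μ ν Ω lam (n + 1)‖
          * ∑ m ∈ Finset.range (n + 1), ‖GCH.subCoeff μ ε ν Ω ω lam c₀ n m‖ := by
  -- Row `n` is padded with zeros, so that after splitting off `m = 0` the recurrence can be
  -- estimated column by column.
  rw [← sum_norm_subCoeff_of_lt (n := n) (N := n + 2 + 1) (by omega),
    Finset.sum_range_succ' _ (n + 2), Finset.sum_range_succ' _ (n + 2), mul_add, ← add_assoc,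
    Finset.mul_sum, Finset.mul_sum, ← Finset.sum_add_distrib]
  refine add_le_add (Finset.sum_le_sum fun m _ => ?_) ?_
  · rw [GCH.subCoeff, ← norm_mul, ← norm_mul]
    exact norm_add_le _ _
  · rw [GCH.subCoeff, norm_mul]

theorem summable_subCoeff (ht : -1 < lam.re) (x : ℂ) :
    Summable fun p : ℕ × ℕ => GCH.subCoeff μ ε ν Ω ω lam c₀ p.1 p.2 * x ^ p.1 := by
  have hT := summable_of_two_term_recurrence
    (C := fun n => ∑ m ∈ Finset.range (n + 1), ‖GCH.subCoeff μ ε ν Ω ω lam c₀ n m‖)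
    (fun n => Finset.sum_nonneg fun _ _ => norm_nonneg _)
    (by simpa using ((tendsto_recA (ε := ε) (ν := ν) (ω := ω) ht).comp (tendsto_add_atTop_nat 1)).norm)
    (by simpa using ((tendsto_recB (μ := μ) (ν := ν) (Ω := Ω) ht).comp (tendsto_add_atTop_nat 1)).norm)
    sum_norm_subCoeff_le ‖x‖ (norm_nonneg _)
  have h0 : ∀ n, ∀ m ∉ Finset.range (n + 1),
      ‖GCH.subCoeff μ ε ν Ω ω lam c₀ n m * x ^ n‖ = 0 := fun n m hm => by
    rw [subCoeff_eq_zero_of_lt (by simpa using hm), zero_mul, norm_zero]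
  refine Summable.of_norm ((summable_prod_of_nonneg fun _ => norm_nonneg _).2
    ⟨fun n => summable_of_ne_finset_zero (h0 n), hT.congr fun n => ?_⟩)
  rw [tsum_eq_sum (h0 n), Finset.sum_mul]
  simp only [norm_mul, norm_pow]

theorem hasSum_frobCoeff (ht : -1 < lam.re) (x : ℂ) :
    HasSum (fun n => GCH.frobCoeff μ ε ν Ω ω lam c₀ n * x ^ n)
      (∑' p : ℕ × ℕ, GCH.subCoeff μ ε ν Ω ω lam c₀ p.1 p.2 * x ^ p.1) := by
  refine (summable_subCoeff ht x).hasSum.prod_fiberwise fun n => ?_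
  rw [← sum_subCoeff n (n + 1) (by omega), Finset.sum_mul]
  refine hasSum_sum_of_ne_finset_zero fun m hm => ?_
  rw [subCoeff_eq_zero_of_lt (by simpa using hm), zero_mul]

theorem recA_two_mul_add (n k : ℕ) : GCH.recA ε ν ω lam (2 * n + k)
    = -(1 / 2) * ε * (n + 1 / 2 * (((k + 1 : ℕ) : ℂ) - 1 + ω + lam))
      / ((((k + 1 : ℕ) : ℂ) / 2 + lam / 2 + n)
        * (GCH.gam ν + ((k + 1 : ℕ) : ℂ) / 2 - 1 + lam / 2 + n)) := by
  rw [GCH.recA, GCH.gam, ← mul_div_mul_left (-(1 / 2) * ε * _) _ (show (4 : ℂ) ≠ 0 by norm_num)]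
  congr 1 <;> push_cast <;> ring

theorem recB_two_mul_add (hμ : μ ≠ 0) (n k : ℕ) : GCH.recB μ ν Ω lam (2 * n + k + 2)
    = -(1 / 2) * μ * (Ω / (2 * μ) + ((k + 1 : ℕ) : ℂ) / 2 + lam / 2 + n)
      / ((((k + 1 : ℕ) : ℂ) / 2 + lam / 2 + (n + 1 : ℕ))
        * (GCH.gam ν + ((k + 1 : ℕ) : ℂ) / 2 - 1 + lam / 2 + (n + 1 : ℕ))) := by
  rw [GCH.recB, GCH.gam, ← mul_div_mul_left (-(1 / 2) * μ * _) _ (show (4 : ℂ) ≠ 0 by norm_num)]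
  congr 1
  · push_cast; field_simp; ring
  · push_cast; ring

theorem recB_two_mul_add_one (hμ : μ ≠ 0) (n : ℕ) : GCH.recB μ ν Ω lam (2 * n + 1)
    = -(1 / 2) * μ * (Ω / (2 * μ) + lam / 2 + n)
      / ((1 + lam / 2 + n) * (GCH.gam ν + lam / 2 + n)) := by
  rw [GCH.recB, GCH.gam, ← mul_div_mul_left (-(1 / 2) * μ * _) _ (show (4 : ℂ) ≠ 0 by norm_num)]
  congr 1
  · push_cast; field_simp; ring
  · push_cast; ring

theorem nestedCoeff_succ_zero (k : ℕ) : nestedCoeff μ ν Ω ω lam (k + 1) 0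
    = ((0 : ℕ) + 1 / 2 * (((k + 1 : ℕ) : ℂ) - 1 + ω + lam)) * nestedCoeff μ ν Ω ω lam k 0
      / ((((k + 1 : ℕ) : ℂ) / 2 + lam / 2 + (0 : ℕ))
        * (GCH.gam ν + ((k + 1 : ℕ) : ℂ) / 2 - 1 + lam / 2 + (0 : ℕ))) := by
  rw [nestedCoeff]
  simp [poch_succ]

/-- The convolution term with `l = 0` gives the first summand. In every other term the last
Pochhammer factors depend only on `i + l`, so they come out of the sum and leave the convolution for
`n`. -/
theorem nestedCoeff_succ_succ (k n : ℕ) : nestedCoeff μ ν Ω ω lam (k + 1) (n + 1)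
    = (((n + 1 : ℕ) : ℂ) + 1 / 2 * (((k + 1 : ℕ) : ℂ) - 1 + ω + lam))
          * nestedCoeff μ ν Ω ω lam k (n + 1)
        / ((((k + 1 : ℕ) : ℂ) / 2 + lam / 2 + (n + 1 : ℕ))
          * (GCH.gam ν + ((k + 1 : ℕ) : ℂ) / 2 - 1 + lam / 2 + (n + 1 : ℕ)))
      + (Ω / (2 * μ) + ((k + 1 : ℕ) : ℂ) / 2 + lam / 2 + n) * nestedCoeff μ ν Ω ω lam (k + 1) n
        / ((((k + 1 : ℕ) : ℂ) / 2 + lam / 2 + (n + 1 : ℕ))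
          * (GCH.gam ν + ((k + 1 : ℕ) : ℂ) / 2 - 1 + lam / 2 + (n + 1 : ℕ))) := by
  rw [nestedCoeff, Finset.Nat.sum_antidiagonal_succ', nestedCoeff, Finset.mul_sum, Finset.sum_div]
  congr 1
  · simp [poch_succ]
  · refine Finset.sum_congr rfl fun p hp => ?_
    rw [← Finset.HasAntidiagonal.mem_antidiagonal.1 hp, poch_succ _ p.2, poch_succ _ (p.2 + 1),
      poch_succ _ (p.2 + 1)]
    rw [mul_div_assoc', div_div]
    congr 1 <;> push_cast <;> ring

/-- The sub-series coefficients are those of the nested integrals. -/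
theorem subCoeff_two_mul_add (hμ : μ ≠ 0) : ∀ m n : ℕ,
    GCH.subCoeff μ ε ν Ω ω lam c₀ (2 * n + m) m
      = c₀ * (-(1 / 2) * μ) ^ n * (-(1 / 2) * ε) ^ m * nestedCoeff μ ν Ω ω lam m n
  | 0, 0 => by simp [GCH.subCoeff, nestedCoeff]
  | 0, n + 1 => by
    have ih := subCoeff_two_mul_add hμ 0 n
    rw [show 2 * (n + 1) + 0 = 2 * n + 2 by ring, GCH.subCoeff, recB_two_mul_add_one hμ]
    rw [add_zero] at ih
    rw [ih, nestedCoeff, nestedCoeff, poch_succ, poch_succ, poch_succ, pow_succ _ n,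
      div_mul_eq_mul_div, mul_div_assoc', mul_div_assoc', div_div]
    ring
  | 1, 0 => by
    have hA := recA_two_mul_add (ε := ε) (ν := ν) (ω := ω) (lam := lam) 0 0
    have ih := subCoeff_two_mul_add hμ 0 0
    simp only [Nat.mul_zero, Nat.zero_add] at hA ih ⊢
    rw [GCH.subCoeff, nestedCoeff_succ_zero, hA, ih]
    simp only [div_eq_mul_inv]
    ring
  | k + 2, 0 => by
    have hA := recA_two_mul_add (ε := ε) (ν := ν) (ω := ω) (lam := lam) 0 (k + 1)
    have ih := subCoeff_two_mul_add hμ (k + 1) 0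
    simp only [Nat.mul_zero, Nat.zero_add] at hA ih ⊢
    -- On the edge `n = m` the `B`-term refers to an entry above the diagonal, which is zero.
    rw [GCH.subCoeff, nestedCoeff_succ_zero, subCoeff_eq_zero_of_lt (n := k) (by omega), hA, ih]
    simp only [div_eq_mul_inv]
    ring
  | k + 1, n + 1 => by
    rw [show 2 * (n + 1) + (k + 1) = 2 * n + k + 1 + 2 by ring, GCH.subCoeff,
      show 2 * n + k + 1 + 1 = 2 * (n + 1) + k by ring, subCoeff_two_mul_add hμ k (n + 1),
      recA_two_mul_add, show 2 * (n + 1) + k = 2 * n + k + 2 by ring, recB_two_mul_add hμ,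
      show 2 * n + k + 1 = 2 * n + (k + 1) by ring, subCoeff_two_mul_add hμ (k + 1) n,
      nestedCoeff_succ_succ]
    simp only [div_eq_mul_inv]
    ring

theorem hasSum_subCoeff_iff (hμ : μ ≠ 0) (m : ℕ) (x s : ℂ) :
    HasSum (fun n => GCH.subCoeff μ ε ν Ω ω lam c₀ n m * x ^ n) s ↔
      HasSum (fun n => c₀ * (-(1 / 2) * ε * x) ^ m
        * (nestedCoeff μ ν Ω ω lam m n * (-(1 / 2) * μ * x ^ 2) ^ n)) s := by
  have hinj : Function.Injective fun n => 2 * n + m := fun a b h => by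
    simp only at h; omega
  rw [← hinj.hasSum_iff fun n hn => by
    rw [subCoeff_eq_zero n m fun i hi => hn ⟨i, hi.symm⟩, zero_mul]]
  have e : (fun n => GCH.subCoeff μ ε ν Ω ω lam c₀ n m * x ^ n) ∘ (fun n => 2 * n + m)
      = fun n => c₀ * (-(1 / 2) * ε * x) ^ m
        * (nestedCoeff μ ν Ω ω lam m n * (-(1 / 2) * μ * x ^ 2) ^ n) := by
    funext n
    simp only [Function.comp_apply]
    rw [subCoeff_two_mul_add hμ, mul_pow _ x, mul_pow _ (x ^ 2), pow_add, pow_mul]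
    ring
  rw [e]

theorem summable_subCoeff_left (ht : -1 < lam.re) (m : ℕ) (x : ℂ) :
    Summable fun n => GCH.subCoeff μ ε ν Ω ω lam c₀ n m * x ^ n :=
  (summable_subCoeff ht x).comp_injective (i := fun n => (n, m)) fun a b h => by simpa using h

theorem summable_baseTerm (hμ : μ ≠ 0) (ht : -1 < lam.re) (w : ℂ) :
    Summable (GCH.baseTerm μ ν Ω lam w) := by
  -- The base series at `w` is `y_0` for `lam`, without its factor `x ^ lam`, at a square root `x`
  -- of `w / (-μ / 2)`.
  obtain ⟨x, hx⟩ := IsAlgClosed.exists_pow_nat_eq (w / (-(1 / 2) * μ)) (n := 2) (by norm_num)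
  have h := (summable_subCoeff_left (μ := μ) (ε := 0) (ν := ν) (Ω := Ω) (ω := 0) (c₀ := 1)
    ht 0 x).hasSum
  rw [hasSum_subCoeff_iff hμ, hx, mul_div_cancel₀ _ (by simpa using hμ)] at h
  refine h.summable.congr fun n => ?_
  rw [pow_zero, mul_one, one_mul, nestedCoeff, GCH.baseTerm]

theorem hasSum_nested (hμ : μ ≠ 0) (ht : -1 < lam.re) (hu : 0 < (ν + lam).re) {r : ℕ → ℝ}
    (hr : ∀ k, r k ∈ Set.Ioo (0 : ℝ) 1) (k : ℕ) (w : ℂ) :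
    HasSum (fun n => nestedCoeff μ ν Ω ω lam k n * w ^ n) (GCH.nested μ ν Ω ω lam r k w) := by
  induction k generalizing w with
  | zero => exact (summable_baseTerm hμ ht w).hasSum
  | succ k ih => exact hasSum_nested_succ ht hu hr ih w

theorem hasSum_subCoeff (hμ : μ ≠ 0) (ht : -1 < lam.re) (hu : 0 < (ν + lam).re) {r : ℕ → ℝ}
    (hr : ∀ k, r k ∈ Set.Ioo (0 : ℝ) 1) (m : ℕ) (x : ℂ) :
    HasSum (fun n => GCH.subCoeff μ ε ν Ω ω lam c₀ n m * x ^ n)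
      (c₀ * (-(1 / 2) * ε * x) ^ m * GCH.nested μ ν Ω ω lam r m (-(1 / 2) * μ * x ^ 2)) :=
  (hasSum_subCoeff_iff hμ m x _).2 ((hasSum_nested hμ ht hu hr m _).mul_left _)

/-- Fubini for the absolutely convergent double series: both sides are its total sum. -/
theorem hasSum_nested_mul_pow (hμ : μ ≠ 0) (ht : -1 < lam.re) (hu : 0 < (ν + lam).re) {r : ℕ → ℝ}
    (hr : ∀ k, r k ∈ Set.Ioo (0 : ℝ) 1) (x : ℂ) :
    HasSum (fun m => c₀ * (-(1 / 2) * ε * x) ^ m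
        * GCH.nested μ ν Ω ω lam r m (-(1 / 2) * μ * x ^ 2))
      (∑' n, GCH.frobCoeff μ ε ν Ω ω lam c₀ n * x ^ n) := by
  rw [(hasSum_frobCoeff ht x).tsum_eq]
  exact ((Equiv.prodComm ℕ ℕ).hasSum_iff.2 (summable_subCoeff ht x).hasSum).prod_fiberwise
    fun m => hasSum_subCoeff hμ ht hu hr m x

end Recurrence

/-! ### The differential equation. -/

section Frobenius

variable {μ ε ν Ω ω lam c₀ : ℂ}

theorem indicial_mul_eq_zero (hlam : lam = 0 ∨ lam = 1 - ν) : lam * (lam - 1 + ν) = 0 := by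
  rcases hlam with rfl | rfl <;> ring

/-- The Frobenius recurrence, with cleared denominators, as an identity between the coefficients of
power series. -/
theorem frobCoeff_recurrence (hlam : lam = 0 ∨ lam = 1 - ν) (ht : -1 < lam.re)
    (hu : 0 < (ν + lam).re) {c : ℕ → ℂ} (hc : c = GCH.frobCoeff μ ε ν Ω ω lam c₀) :
    (2 * lam + ν) * c 1 + ε * (lam + ω) * c 0 = 0 ∧
    ∀ n : ℕ, ((n : ℂ) + 1 + 2 * lam + ν) * (((n : ℂ) + 1 + 1) * c (n + 2))
      + ε * ((n : ℂ) + 1 + lam + ω) * c (n + 1) + (μ * (n + lam) + Ω) * c n = 0 := by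
  have hi := indicial_mul_eq_zero hlam
  subst hc
  constructor
  · have h1 : (1 + lam) ≠ 0 := by simpa using natCast_add_one_add_ne_zero ht 0
    have h2 : (ν + lam) ≠ 0 := by simpa using natCast_add_add_ne_zero hu 0
    have hA : (1 + lam) * (ν + lam) * GCH.recA ε ν ω lam 0 = -(ε * (ω + lam)) := by
      rw [GCH.recA]; push_cast; simp only [zero_add]; field_simp
    rw [GCH.frobCoeff, GCH.frobCoeff]
    -- The denominators in `A`, `B` and the factor required here differ by the indicial polynomial:
    -- `(k + lam) (k - 1 + ν + lam) - k (k - 1 + 2 lam + ν) = lam (lam - 1 + ν)`; here `k = 1`,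
    -- below `k = n + 2`.
    linear_combination c₀ * hA - GCH.recA ε ν ω lam 0 * c₀ * hi
  · intro n
    have h1 : ((n : ℂ) + 1 + 1 + lam) ≠ 0 := by
      simpa using natCast_add_one_add_ne_zero ht (n + 1)
    have h2 : ((n : ℂ) + 1 + ν + lam) ≠ 0 := by simpa using natCast_add_add_ne_zero hu (n + 1)
    have hA : ((n : ℂ) + 1 + 1 + lam) * (n + 1 + ν + lam) * GCH.recA ε ν ω lam (n + 1)
        = -(ε * (n + 1 + ω + lam)) := by
      rw [GCH.recA]; push_cast; field_simp
    have hB : ((n : ℂ) + 1 + 1 + lam) * (n + 1 + ν + lam) * GCH.recB μ ν Ω lam (n + 1)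
        = -(Ω + μ * (n + lam)) := by
      rw [GCH.recB]; push_cast; field_simp; ring
    rw [GCH.frobCoeff]
    linear_combination GCH.frobCoeff μ ε ν Ω ω lam c₀ (n + 1) * hA
      + GCH.frobCoeff μ ε ν Ω ω lam c₀ n * hB
      - (GCH.recA ε ν ω lam (n + 1) * GCH.frobCoeff μ ε ν Ω ω lam c₀ (n + 1)
        + GCH.recB μ ν Ω lam (n + 1) * GCH.frobCoeff μ ε ν Ω ω lam c₀ n) * hi

/-- The regular factor of the Frobenius series is entire and satisfies the reduced equation. -/
theorem exists_deriv_frobCoeff_tsum (hlam : lam = 0 ∨ lam = 1 - ν) (ht : -1 < lam.re)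
    (hu : 0 < (ν + lam).re) {P : ℂ → ℂ}
    (hP : P = fun x => ∑' n, GCH.frobCoeff μ ε ν Ω ω lam c₀ n * x ^ n) :
    ∃ P₁ P₂ : ℂ → ℂ, (∀ x, HasDerivAt P (P₁ x) x) ∧ (∀ x, HasDerivAt P₁ (P₂ x) x) ∧
      ∀ x, x * P₂ x + (2 * lam + ν + ε * x + μ * x ^ 2) * P₁ x
        + ((lam * μ + Ω) * x + ε * (lam + ω)) * P x = 0 := by
  set c := GCH.frobCoeff μ ε ν Ω ω lam c₀ with hc
  have hs : ∀ x : ℂ, Summable fun n => c n * x ^ n := fun x => (hasSum_frobCoeff ht x).summable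
  have hs₁ := summable_succ_mul_pow hs
  have hs₂ := summable_succ_mul_pow hs₁
  refine ⟨_, _, fun x => hP ▸ hasDerivAt_tsum_mul_pow hs x,
    fun x => hasDerivAt_tsum_mul_pow hs₁ x, fun x => ?_⟩
  obtain ⟨hr0, hr⟩ := frobCoeff_recurrence hlam ht hu hc
  have h0 : HasSum (fun n => c n * x ^ n) (P x) := by rw [hP]; exact (hs x).hasSum
  have h1 := (hs₁ x).hasSum
  -- `x P''`, `x P'`, `x² P'` and `x P` are all expanded in `x ^ n`, so that the equation can be
  -- checked coefficientwise.
  have h2 := hasSum_mul_pow_shift (b := fun n : ℕ => n * ((n + 1) * c (n + 1))) (hs₂ x).hasSum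
    (by simp) (fun n => by push_cast; ring)
  have hx1 := hasSum_mul_pow_shift (b := fun n : ℕ => n * c n) h1 (by simp)
    (fun n => by push_cast; ring)
  have hxx1 := hasSum_mul_pow_shift
    (b := fun n : ℕ => if n = 0 then 0 else ((n - 1 : ℕ) : ℂ) * c (n - 1)) hx1 (by simp)
    (by simp)
  have hx0 := hasSum_mul_pow_shift
    (b := fun n : ℕ => if n = 0 then 0 else c (n - 1)) h0 (by simp) (by simp)
  have hsum := ((((h2.add (h1.mul_left (2 * lam + ν))).add (hx1.mul_left ε)).add
    (hxx1.mul_left μ)).add (hx0.mul_left (lam * μ + Ω))).add (h0.mul_left (ε * (lam + ω)))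
  have := hsum.congr_fun (g := fun _ => (0 : ℂ)) fun n => by
    cases n with
    | zero => simp only [Nat.cast_zero, pow_zero, if_true]; linear_combination -hr0
    | succ n =>
      have := hr n
      simp only [Nat.add_one_ne_zero, if_false, Nat.add_sub_cancel]
      push_cast at this ⊢
      linear_combination (-x ^ (n + 1)) * this
  rw [← this.unique hasSum_zero]
  ring

/-- At `x = 0` splitting the exponent needs `lam = 0`, where `0 ^ 0 = 1`. -/
theorem cpow_natCast_add {x : ℂ} (hx : x ≠ 0 ∨ lam = 0) (n : ℕ) :
    x ^ ((n : ℂ) + lam) = x ^ lam * x ^ n := by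
  rcases hx with hx | rfl
  · rw [Complex.cpow_add _ _ hx, Complex.cpow_natCast, mul_comm]
  · simp

theorem frobSeries_eq {x : ℂ} (hx : x ≠ 0 ∨ lam = 0) : GCH.frobSeries μ ε ν Ω ω lam c₀ x
    = x ^ lam * ∑' n, GCH.frobCoeff μ ε ν Ω ω lam c₀ n * x ^ n := by
  rw [GCH.frobSeries, ← tsum_mul_left]
  exact tsum_congr fun n => by rw [cpow_natCast_add hx]; ring

/-- Multiplication by `x ^ lam`, with `lam` an indicial root, turns solutions of the reduced
equation into solutions of the grand confluent hypergeometric equation. -/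
theorem cpow_mul_solves (hi : lam * (lam - 1 + ν) = 0) {y P P₁ P₂ : ℂ → ℂ}
    (hP : ∀ x, HasDerivAt P (P₁ x) x) (hP₁ : ∀ x, HasDerivAt P₁ (P₂ x) x)
    (heq : ∀ x, x * P₂ x + (2 * lam + ν + ε * x + μ * x ^ 2) * P₁ x
        + ((lam * μ + Ω) * x + ε * (lam + ω)) * P x = 0)
    (hy : ∀ x ∈ Complex.slitPlane, y x = x ^ lam * P x) {x : ℂ} (hx : x ∈ Complex.slitPlane) :
    AnalyticAt ℂ y x ∧ x * deriv (deriv y) x + (μ * x ^ 2 + ε * x + ν) * deriv y x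
        + (Ω * x + ε * ω) * y x = 0 := by
  have hcpow : ∀ (b : ℂ), ∀ z ∈ Complex.slitPlane,
      HasDerivAt (fun z : ℂ => z ^ b) (b * z ^ (b - 1)) z := fun b z hz => by
    simpa using (hasDerivAt_id z).cpow_const (c := b) hz
  have hev : ∀ z ∈ Complex.slitPlane, y =ᶠ[𝓝 z] fun z => z ^ lam * P z := fun z hz =>
    Filter.eventuallyEq_of_mem (Complex.isOpen_slitPlane.mem_nhds hz) hy
  have hd : ∀ z ∈ Complex.slitPlane,
      HasDerivAt y (lam * z ^ (lam - 1) * P z + z ^ lam * P₁ z) z := fun z hz =>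
    ((hcpow lam z hz).fun_mul (hP z)).congr_of_eventuallyEq (hev z hz)
  have hev' : deriv y =ᶠ[𝓝 x] fun z => lam * z ^ (lam - 1) * P z + z ^ lam * P₁ z :=
    Filter.eventuallyEq_of_mem (Complex.isOpen_slitPlane.mem_nhds hx) fun z hz => (hd z hz).deriv
  have hd2 := (((((hcpow (lam - 1) x hx).const_mul lam).fun_mul (hP x)).fun_add
    ((hcpow lam x hx).fun_mul (hP₁ x))).congr_of_eventuallyEq hev').deriv
  refine ⟨?_, ?_⟩
  · exact DifferentiableOn.analyticAt
      (fun z hz => (hd z hz).differentiableAt.differentiableWithinAt)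
      (Complex.isOpen_slitPlane.mem_nhds hx)
  · have hx0 := Complex.slitPlane_ne_zero hx
    -- All powers are reduced to `x ^ (lam - 2)`; the term `lam (lam - 1 + ν)` left over vanishes at
    -- an indicial root.
    have e1 : x ^ lam = x ^ (lam - 1 - 1) * x ^ 2 := by
      rw [← Complex.cpow_natCast, ← Complex.cpow_add _ _ hx0]; congr 1; push_cast; ring
    have e2 : x ^ (lam - 1) = x ^ (lam - 1 - 1) * x := by
      have := Complex.cpow_add (lam - 1 - 1) 1 hx0
      rwa [Complex.cpow_one, sub_add_cancel] at this
    rw [hd2, (hd x hx).deriv, hy x hx, e1, e2]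
    linear_combination x ^ (lam - 1 - 1) * x ^ 2 * heq x + x ^ (lam - 1 - 1) * x * P x * hi

end Frobenius

/-! ### Assembly. -/

theorem theorem2 (μ ε ν Ω ω lam c₀ : ℂ) (hμ : μ ≠ 0)
    -- `lam` is an indicial root
    (hlam : lam = 0 ∨ lam = 1 - ν)
    -- convergence of the beta-type integrals at the endpoint `0`
    (ht : -1 < lam.re) (hu : 0 < (ν + lam).re)
    -- radii of the contours
    (r : ℕ → ℝ) (hr : ∀ k, r k ∈ Set.Ioo (0 : ℝ) 1) :
    -- the Frobenius series converges and solves the grand confluent hypergeometric equation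
    (∀ x : ℂ, x ≠ 0 ∨ lam = 0 →
      Summable fun n : ℕ => GCH.frobCoeff μ ε ν Ω ω lam c₀ n * x ^ ((n : ℂ) + lam)) ∧
    (∀ x : ℂ, x ∈ Complex.slitPlane ∨ lam = 0 →
      AnalyticAt ℂ (GCH.frobSeries μ ε ν Ω ω lam c₀) x ∧
      x * deriv (deriv (GCH.frobSeries μ ε ν Ω ω lam c₀)) x
        + (μ * x ^ 2 + ε * x + ν) * deriv (GCH.frobSeries μ ε ν Ω ω lam c₀) x
        + (Ω * x + ε * ω) * GCH.frobSeries μ ε ν Ω ω lam c₀ x = 0) ∧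
    -- all series, derivatives and integrals on the right-hand side exist
    (∀ w : ℂ, Summable (GCH.baseTerm μ ν Ω lam w)) ∧
    (∀ k : ℕ, Differentiable ℂ (GCH.nested μ ν Ω ω lam r k)) ∧
    (∀ (k : ℕ) (w : ℂ),
      IntervalIntegrable
        (GCH.tIntegrand μ ν Ω ω lam (r (k + 1)) (k + 1) (GCH.nested μ ν Ω ω lam r k) w)
        MeasureTheory.volume 0 1 ∧
      ∀ t ∈ Set.Icc (0 : ℝ) 1,
        IntervalIntegrable
          (GCH.uIntegrand μ ν Ω ω lam (r (k + 1)) (k + 1) (GCH.nested μ ν Ω ω lam r k) w t)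
          MeasureTheory.volume 0 1 ∧
        ∀ u ∈ Set.Icc (0 : ℝ) 1,
          CircleIntegrable
            (GCH.contourIntegrand μ Ω ω lam (k + 1) (GCH.nested μ ν Ω ω lam r k) w t u)
            1 (r (k + 1))) ∧
    -- the representation, term by term and in total
    (∀ x : ℂ, x ≠ 0 ∨ lam = 0 →
      (∀ m : ℕ,
        (Summable fun n : ℕ => GCH.subCoeff μ ε ν Ω ω lam c₀ n m * x ^ ((n : ℂ) + lam)) ∧
        GCH.subSeries μ ε ν Ω ω lam c₀ m x
          = c₀ * x ^ lam
            * (GCH.nested μ ν Ω ω lam r m (-(1 / 2) * μ * x ^ 2) * (-(1 / 2) * ε * x) ^ m)) ∧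
      HasSum (fun m : ℕ => GCH.subSeries μ ε ν Ω ω lam c₀ m x)
        (GCH.frobSeries μ ε ν Ω ω lam c₀ x) ∧
      (Summable fun n : ℕ =>
        GCH.nested μ ν Ω ω lam r (n + 1) (-(1 / 2) * μ * x ^ 2)
          * (-(1 / 2) * ε * x) ^ (n + 1)) ∧
      GCH.frobSeries μ ε ν Ω ω lam c₀ x
        = c₀ * x ^ lam
          * (GCH.base μ ν Ω lam (-(1 / 2) * μ * x ^ 2)
            + ∑' n : ℕ,
                GCH.nested μ ν Ω ω lam r (n + 1) (-(1 / 2) * μ * x ^ 2)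
                  * (-(1 / 2) * ε * x) ^ (n + 1))) := by
  have hnested := hasSum_nested (Ω := Ω) (ω := ω) hμ ht hu hr
  have hdiff : ∀ k, Differentiable ℂ (GCH.nested μ ν Ω ω lam r k) := fun k => by
    rw [show GCH.nested μ ν Ω ω lam r k = fun w => ∑' n, nestedCoeff μ ν Ω ω lam k n * w ^ n from
      funext fun w => (hnested k w).tsum_eq.symm]
    exact fun w => (hasDerivAt_tsum_mul_pow (fun w => (hnested k w).summable) w).differentiableAt
  refine ⟨fun x hx => ?_, fun x hx => ?_, summable_baseTerm hμ ht, hdiff, fun k w => ⟨?_, ?_⟩,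
    fun x hx => ?_⟩
  · exact ((hasSum_frobCoeff ht x).summable.mul_left (x ^ lam)).congr fun n => by
      rw [cpow_natCast_add hx]; ring
  · obtain ⟨P₁, P₂, hP, hP₁, heq⟩ :=
      exists_deriv_frobCoeff_tsum (μ := μ) (ε := ε) (Ω := Ω) (ω := ω) (c₀ := c₀) hlam ht hu rfl
    -- For `lam = 0` the solution is `P` itself, so the branch cut plays no role.
    rcases eq_or_ne lam 0 with h0 | h0
    · have hy : GCH.frobSeries μ ε ν Ω ω lam c₀
          = fun x => ∑' n, GCH.frobCoeff μ ε ν Ω ω lam c₀ n * x ^ n := funext fun x => by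
        rw [frobSeries_eq (.inr h0), h0, Complex.cpow_zero, one_mul]
      rw [hy, funext fun z => (hP z).deriv, (hP₁ x).deriv]
      refine ⟨Differentiable.analyticAt (fun z => (hP z).differentiableAt) x, ?_⟩
      have := heq x
      rw [h0] at this ⊢
      linear_combination this
    · exact cpow_mul_solves (indicial_mul_eq_zero hlam) hP hP₁ heq
        (fun z hz => frobSeries_eq (.inl (Complex.slitPlane_ne_zero hz))) (hx.resolve_right h0)
  · exact (tIntegrand_expansion (hr (k + 1)) (re_half_pos ht k) (re_gam_pos hu k) (hnested k) w).1
  · exact fun t htI => ⟨(uIntegrand_expansion (hr (k + 1)) (re_gam_pos hu k) (hnested k) w htI).1,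
      fun u _ => circleIntegrable_contourIntegrand (hr (k + 1)) (hdiff k) w t u⟩
  · have hterm : ∀ m, HasSum
        (fun n : ℕ => GCH.subCoeff μ ε ν Ω ω lam c₀ n m * x ^ ((n : ℂ) + lam))
        (c₀ * x ^ lam * (GCH.nested μ ν Ω ω lam r m (-(1 / 2) * μ * x ^ 2)
          * (-(1 / 2) * ε * x) ^ m)) := fun m => by
      have h := (hasSum_subCoeff (ε := ε) (Ω := Ω) (ω := ω) (c₀ := c₀) hμ ht hu hr m x).mul_left
        (x ^ lam)
      rw [show c₀ * x ^ lam * (GCH.nested μ ν Ω ω lam r m (-(1 / 2) * μ * x ^ 2)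
          * (-(1 / 2) * ε * x) ^ m) = x ^ lam * (c₀ * (-(1 / 2) * ε * x) ^ m
            * GCH.nested μ ν Ω ω lam r m (-(1 / 2) * μ * x ^ 2)) by ring]
      exact h.congr_fun fun n => by rw [cpow_natCast_add hx]; ring
    have hsub : ∀ m, GCH.subSeries μ ε ν Ω ω lam c₀ m x = c₀ * x ^ lam
        * (GCH.nested μ ν Ω ω lam r m (-(1 / 2) * μ * x ^ 2) * (-(1 / 2) * ε * x) ^ m) :=
      fun m => (hterm m).tsum_eq
    have htotal : HasSum (fun m : ℕ => GCH.subSeries μ ε ν Ω ω lam c₀ m x)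
        (GCH.frobSeries μ ε ν Ω ω lam c₀ x) := by
      rw [frobSeries_eq hx]
      exact ((hasSum_nested_mul_pow hμ ht hu hr x).mul_left (x ^ lam)).congr_fun fun m =>
        (hsub m).trans (by ring)
    -- Taken with `c₀ = 1`, since nothing could be deduced from a series multiplied by `c₀ = 0`.
    have hsummable : Summable fun n : ℕ => GCH.nested μ ν Ω ω lam r n (-(1 / 2) * μ * x ^ 2)
        * (-(1 / 2) * ε * x) ^ n :=
      (hasSum_nested_mul_pow (ε := ε) (Ω := Ω) (ω := ω) (c₀ := 1) hμ ht hu hr x).summable.congr fun n => by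
        ring
    refine ⟨fun m => ⟨(hterm m).summable, hsub m⟩, htotal,
      (summable_nat_add_iff 1).2 hsummable, ?_⟩
    rw [← htotal.tsum_eq, tsum_congr hsub, tsum_mul_left, hsummable.tsum_eq_zero_add, pow_zero,
      mul_one, GCH.nested]
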